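/- Spaces are point-free: for a propositional geometric theory $T$, $[T]$ denotes the locale whose frame of opens is presented by $T$; points of $[T]$ at stage $F$ ($F$ any frame) are the models of $T$ in $F$, and ordinary points are the models in truth values. Reals are Dedekind sections $(L,U)$ of $\mathbb{Q}$ (rounded, inhabited, disjoint, located). A positive definite Dedekind absolute value on $\mathbb{Q}$ is a map $|\cdot|\colon\mathbb{Q}\to[0,\infty)$ (Dedekind reals) with $|0|=0$, $|1|=1$, $|xy|=|x||y|$, $|x+y|\le|x|+|y|$, and $x=0$ or $|x|>0$ for every $x$. It is non-Archimedean if $|n|<1$ for some non-zero integer $n$. Let $[\mathrm{av}_{NA}]$ be the point-free space of non-Archimedean positive definite Dedekind absolute values on $\mathbb{Q}$, let $\mathbb{P}$ be the discrete space of prime numbers, and let $(-\infty,0)$ be the space of negative Dedekind reals. For a prime $p$ let $|\cdot|_p$ be the $p$-adic absolute value, $|x|_p=p^{-\mathrm{ord}_p(x)}$ for $x\neq 0$ and $|0|_p=0$. **Proposition.** There is an isomorphism of point-free spaces $$[\mathrm{av}_{NA}]\;\cong\;\mathbb{P}\times(-\infty,0),$$ under which $(p,\lambda)$ corresponds to the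 absolute value with $|x|=\left(p^{\mathrm{ord}_p(x)}\right)^{\lambda}=|x|_p^{-\lambda}$ for $x\ne 0$ (and $|0|=0$). **Corollary.** For every non-Archimedean positive definite Dedekind absolute value $|\cdot|$ on $\mathbb{Q}$, at any stage $F$, and every prime $p$ with $|p|<1$, there is a Dedekind real $\alpha\in(0,\infty)$ at stage $F$ such that $|\cdot|=|\cdot|_p^{\alpha}$. In particular every ordinary such absolute value is $|\cdot|_p^{\alpha}$ for some prime $p$ and some real $\alpha>0$. -/

import Mathlib

open CategoryTheory Order

universe u

/-! ### Propositional geometric theories, their models and their point-free spaces -/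

/-- A propositional geometric theory in sequent normal form: `Ax h C` says that the sequent
`⋀ h ⟶ ⋁_{c ∈ C} ⋀ c` is an axiom, where `h` and each `c ∈ C` are finite sets of atoms. -/
structure GeomTheory where
  Atom : Type
  Ax : Finset Atom → Set (Finset Atom) → Prop

namespace GeomTheory

/-- A model of `T` in a frame `F`, i.e. in the topos of sheaves on the corresponding locale.
For `F = Prop` these are the ordinary (global) points of the space `[T]`. -/
structure Model (T : GeomTheory) (F : Type u) [Frame F] where
  val : T.Atom → F
  sound : ∀ h C, T.Ax h C → h.inf val ≤ ⨆ c ∈ C, c.inf val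

/-- The frame of opens of `[T]`, presented by generators and relations.
The free frame on the atoms is the frame of families of finite conjunctions that are closed
under strengthening (each standing for the disjunction of its members); the frame
presented by `T` consists of those families that are moreover saturated for the axioms: if `t`
entails `⋀ h`, and all common strengthenings of `t` with the members `c` of `C` are in the
family, then so is `t`. -/
def opens (T : GeomTheory) : Sublocale (LowerSet (Finset T.Atom)ᵒᵈ) where
  carrier := {U | ∀ h C, T.Ax h C → ∀ t : Finset T.Atom, h ⊆ t →
    (∀ c ∈ C, ∀ s : Finset T.Atom, t ⊆ s → c ⊆ s → OrderDual.toDual s ∈ U) →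
      OrderDual.toDual t ∈ U}
  sInf_mem' := by
    intro S hS h C hA t ht H
    rw [LowerSet.mem_sInf_iff]
    intro U hU
    refine hS hU h C hA t ht fun c hc s hts hcs => ?_
    exact LowerSet.mem_sInf_iff.1 (H c hc s hts hcs) U hU
  himp_mem' := by
    have key : ∀ (A B : LowerSet (Finset T.Atom)ᵒᵈ) (t : (Finset T.Atom)ᵒᵈ),
        t ∈ A ⇨ B ↔ ∀ s ≤ t, s ∈ A → s ∈ B := by
      intro A B t
      rw [← LowerSet.Iic_le, le_himp_iff]
      constructor
      · intro H s hst hs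
        exact H ⟨hst, hs⟩
      · rintro H s ⟨hst, hs⟩
        exact H s hst hs
    intro A B hB h C hA t ht H
    rw [key]
    intro s hst hs
    refine hB h C hA s.ofDual (ht.trans hst) fun c hc r hsr hcr => ?_
    have h1 := H c hc r (Finset.Subset.trans hst hsr) hcr
    rw [key] at h1
    exact h1 _ le_rfl (A.lower hsr hs)

/-- The point-free space `[T]`: the locale whose frame of opens is presented by `T`. -/
def space (T : GeomTheory) : Locale.{0} := Locale.of T.opens

/-- The open of `[T]` given by an atom. -/
noncomputable def basicOpen (T : GeomTheory) (a : T.Atom) : T.opens :=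
  T.opens.restrict (LowerSet.Iic (OrderDual.toDual {a}))

/-- The subspace of `[T]` cut out by additional axioms. -/
abbrev adjoin (T : GeomTheory) (E : Finset T.Atom → Set (Finset T.Atom) → Prop) : GeomTheory where
  Atom := T.Atom
  Ax h C := T.Ax h C ∨ E h C

/-- The axioms of the theory of pairs of a model of `T` and a model of `S`. -/
inductive ProdAx (T S : GeomTheory) :
    Finset (T.Atom ⊕ S.Atom) → Set (Finset (T.Atom ⊕ S.Atom)) → Prop
  | left {h C} : T.Ax h C → ProdAx T S (h.map .inl) (Finset.map .inl '' C)
  | right {h C} : S.Ax h C → ProdAx T S (h.map .inr) (Finset.map .inr '' C)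

/-- The theory whose models are pairs of a model of `T` and a model of `S`;
its space is `[T] × [S]`. -/
abbrev prod (T S : GeomTheory) : GeomTheory := ⟨T.Atom ⊕ S.Atom, ProdAx T S⟩

/-- The axioms of the theory of `I`-indexed families of models of `T`. -/
inductive FamilyAx (I : Type) (T : GeomTheory) :
    Finset (Σ _ : I, T.Atom) → Set (Finset (Σ _ : I, T.Atom)) → Prop
  | mk (i : I) {h C} : T.Ax h C → FamilyAx I T (h.map (.sigmaMk i)) (Finset.map (.sigmaMk i) '' C)

/-- The theory of maps from the (discrete) set `I` to the space `[T]`. -/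
abbrev family (I : Type) (T : GeomTheory) : GeomTheory := ⟨Σ _ : I, T.Atom, FamilyAx I T⟩

/-- The axioms for an element of the set `S`; the atom `s` reads "the element is `s`". -/
inductive DiscreteAx (S : Type) : Finset S → Set (Finset S) → Prop
  | exists_eq : DiscreteAx S ∅ (Set.range fun s => {s})
  | unique (s t : S) (h : Finset S) : s ∈ h → t ∈ h → s ≠ t → DiscreteAx S h ∅

/-- The theory of elements of a set `S`, whose space is the discrete space `S`. -/
abbrev discrete (S : Type) : GeomTheory := ⟨S, DiscreteAx S⟩

end GeomTheory

open GeomTheory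

/-- The inverse image frame homomorphism of a map of locales. -/
def Locale.invImage {X Y : Locale.{0}} (f : X ⟶ Y) : FrameHom Y X :=
  (Quiver.Hom.unop f).hom

/-! ### Dedekind reals -/

/-- For a real `x`, the atom `lt q` reads `q < x` and the atom `gt q` reads `x < q`. -/
inductive RealAtom
  | lt (q : ℚ)
  | gt (q : ℚ)

/-- The axioms of a Dedekind section: both halves are rounded and inhabited, and the section is
disjoint and located. -/
inductive DedekindAx : Finset RealAtom → Set (Finset RealAtom) → Prop
  | lower (q r : ℚ) : q < r → DedekindAx {.lt r} {{.lt q}}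
  | lower_rounded (q : ℚ) : DedekindAx {.lt q} {c | ∃ r, q < r ∧ c = {.lt r}}
  | lower_inhabited : DedekindAx ∅ {c | ∃ q, c = {.lt q}}
  | upper (q r : ℚ) : q < r → DedekindAx {.gt q} {{.gt r}}
  | upper_rounded (r : ℚ) : DedekindAx {.gt r} {c | ∃ q, q < r ∧ c = {.gt q}}
  | upper_inhabited : DedekindAx ∅ {c | ∃ q, c = {.gt q}}
  | disjoint (q : ℚ) (h : Finset RealAtom) : .lt q ∈ h → .gt q ∈ h → DedekindAx h ∅
  | located (q r : ℚ) : q < r → DedekindAx ∅ {{.lt q}, {.gt r}}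

/-- The theory of Dedekind reals. -/
abbrev dedekind : GeomTheory := ⟨RealAtom, DedekindAx⟩

/-- The theory of non-negative Dedekind reals: the closed subspace `[0,∞)`. -/
abbrev dedekindNonneg : GeomTheory := dedekind.adjoin fun h C => h = {RealAtom.gt 0} ∧ C = ∅

/-- The theory of negative Dedekind reals: the open subspace `(-∞,0)`. -/
abbrev dedekindNeg : GeomTheory := dedekind.adjoin fun h C => h = ∅ ∧ C = {{RealAtom.gt 0}}

/-- The theory of positive Dedekind reals: the open subspace `(0,∞)`. -/
abbrev dedekindPos : GeomTheory := dedekind.adjoin fun h C => h = ∅ ∧ C = {{RealAtom.lt 0}}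

/-- For the Dedekind section `x` in the frame `F` given by `v`, the truth value of `x ∈ W`, where
`W ⊆ ℝ` is open: the join of the truth values of `a < x < b` over the rational intervals
`(a, b) ⊆ W`. -/
def realMem {F : Type u} [Frame F] (v : RealAtom → F) (W : Set ℝ) : F :=
  ⨆ (a : ℚ) (b : ℚ) (_ : Set.Ioo (a : ℝ) (b : ℝ) ⊆ W), v (.lt a) ⊓ v (.gt b)

/-! ### Absolute values -/

/-- The theory of maps `|·| : R → [0,∞)` into the non-negative Dedekind reals. -/
abbrev realMaps (R : Type) : GeomTheory := family R dedekindNonneg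

/-- The atom `|x| < q`. -/
abbrev absLt {R : Type} (x : R) (q : ℚ) : (realMaps R).Atom :=
  (⟨x, RealAtom.gt q⟩ : Σ _ : R, RealAtom)

/-- The atom `q < |x|`. -/
abbrev ltAbs {R : Type} (q : ℚ) (x : R) : (realMaps R).Atom :=
  (⟨x, RealAtom.lt q⟩ : Σ _ : R, RealAtom)

open Classical in
/-- The axioms of a positive definite absolute value: `|0| = 0`, `|1| = 1`, `|xy| = |x||y|`,
`|x + y| ≤ |x| + |y|`, and `x = 0 ∨ |x| > 0`. -/
inductive AbsAx (R : Type) [CommRing R] :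
    Finset (realMaps R).Atom → Set (Finset (realMaps R).Atom) → Prop
  | zero (q : ℚ) : 0 < q → AbsAx R ∅ {{absLt 0 q}}
  | one_le (q : ℚ) : 1 < q → AbsAx R ∅ {{absLt 1 q}}
  | le_one (q : ℚ) : q < 1 → AbsAx R ∅ {{ltAbs q 1}}
  | mul_le (x y : R) (r s : ℚ) : AbsAx R {absLt x r, absLt y s} {{absLt (x * y) (r * s)}}
  | le_mul (x y : R) (q : ℚ) : AbsAx R {absLt (x * y) q}
      {c | ∃ r s : ℚ, 0 < r ∧ 0 < s ∧ r * s ≤ q ∧ c = {absLt x r, absLt y s}}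
  | add_le (x y : R) (r s : ℚ) : AbsAx R {absLt x r, absLt y s} {{absLt (x + y) (r + s)}}
  | pos_def (x : R) : AbsAx R ∅ ({c | x = 0 ∧ c = ∅} ∪ {{ltAbs 0 x}})

/-- The theory of positive definite Dedekind absolute values on `R`. -/
abbrev dedekindAbs (R : Type) [CommRing R] : GeomTheory := (realMaps R).adjoin (AbsAx R)

/-- The theory of non-Archimedean positive definite Dedekind absolute values on `ℚ`: the open
subspace of those for which `|n| < 1` for some non-zero integer `n`. -/
abbrev nonArchAbs : GeomTheory :=
  (dedekindAbs ℚ).adjoin fun h C =>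
    h = ∅ ∧ C = {c | ∃ n : ℤ, n ≠ 0 ∧ c = {absLt (n : ℚ) 1}}

/-- The theory of pairs of a prime number and a negative Dedekind real. -/
abbrev primeNegReal : GeomTheory := (discrete Nat.Primes).prod dedekindNeg

/-- The open "the first component is `p`" of the space `ℙ × (-∞,0)`. -/
noncomputable def primeIs (p : Nat.Primes) : primeNegReal.opens :=
  primeNegReal.basicOpen (.inl p)

/-- The opens "`q < λ`" and "`λ < q`" of the space `ℙ × (-∞,0)`, where `λ` is the second
component. -/
noncomputable def expAtom (a : RealAtom) : primeNegReal.opens :=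
  primeNegReal.basicOpen (.inr a)

/-! The opens of `[T]` are the classifying frame of `T`: frame homomorphisms out of `T.opens`
correspond to models of `T`, and they are determined by the atoms (`Model.lift`, `frameHom_ext`). A
theory with countably many axioms has, classically, enough ordinary points: an inequality between
opens holds as soon as it holds at every model in `Prop` (`IsCountable.le_of_forall_model`, a
Rasiowa–Sikorski argument). All theories here are countable because `ℚ` is.

So everything reduces to ordinary points. These are pairs of a prime and a negative real on one
side, and real-valued absolute values on the other. By Ostrowski's theorem the latter are the
functions `|·|_p ^ c` with `c > 0`. The prime is recovered as the only one with `|p| < 1`, and the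
exponent from `|p| = p ^ (-c)`. Both passages are expressed by opens (`absOpen`, `primeExpOpen`).
Since these form models at every ordinary point, they are models in the frames of opens, and the
induced frame homomorphisms are mutually inverse because they are so pointwise.

A stage `F` may have no points, but a model in `F` is a frame homomorphism, and equations between
opens can be transported along it. This gives the corollary from `primeIs_inf_absOpen`. -/

namespace GeomTheory

variable {T S : GeomTheory}

/-! ### The universal property of the frame of opens -/

theorem restrict_le_iff {U : LowerSet (Finset T.Atom)ᵒᵈ} {V : T.opens} :
    T.opens.restrict U ≤ V ↔ U ≤ V.1 :=
  T.opens.giRestrict.gc U V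

theorem restrict_Iic_le_iff {t : Finset T.Atom} {V : T.opens} :
    T.opens.restrict (LowerSet.Iic (OrderDual.toDual t)) ≤ V ↔ OrderDual.toDual t ∈ V.1 := by
  rw [restrict_le_iff, LowerSet.Iic_le]

namespace Model

variable {F : Type u} [Frame F]

/-- The largest open of `[T]` whose value at the model `M` lies below `b`. -/
def below (M : T.Model F) (b : F) : T.opens where
  val := ⟨{t | t.ofDual.inf M.val ≤ b}, fun _ _ hst hs => (Finset.inf_mono hst).trans hs⟩
  property := by
    classical
    intro h C hA t ht H
    change t.inf M.val ≤ b
    have h1 : t.inf M.val ≤ ⨆ c ∈ C, c.inf M.val :=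
      (Finset.inf_mono ht).trans (M.sound h C hA)
    -- Distributivity splits `t` into the cases `t ∪ c`, each covered by `H`.
    calc t.inf M.val ≤ t.inf M.val ⊓ ⨆ c ∈ C, c.inf M.val := le_inf le_rfl h1
      _ ≤ b := by
        rw [inf_iSup₂_eq]
        refine iSup₂_le fun c hc => ?_
        rw [← Finset.inf_union]
        exact H c hc (t ∪ c) Finset.subset_union_left Finset.subset_union_right

/-- The value of an open of `[T]` at a model of `T`. -/
def liftFun (M : T.Model F) (U : T.opens) : F :=
  ⨆ (t : Finset T.Atom) (_ : OrderDual.toDual t ∈ U.1), t.inf M.val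

theorem liftFun_le_iff (M : T.Model F) {U : T.opens} {b : F} :
    M.liftFun U ≤ b ↔ U ≤ M.below b :=
  iSup₂_le_iff

/-- As a left adjoint, `liftFun` preserves all joins, so only finite meets remain to be checked for
a frame homomorphism. -/
theorem gc_liftFun_below (M : T.Model F) : GaloisConnection M.liftFun M.below :=
  fun _ _ => M.liftFun_le_iff

open Classical in
/-- The frame homomorphism classifying a model of `T`: its value at an open of `[T]` is the
interpretation of that open in the model. -/
def lift (M : T.Model F) : FrameHom T.opens F where
  toFun := M.liftFun
  map_inf' U V := by
    apply le_antisymm (M.gc_liftFun_below.monotone_l.map_inf_le U V)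
    simp only [liftFun, iSup_inf_eq, inf_iSup_eq]
    refine iSup₂_le fun s hs => iSup₂_le fun t ht => ?_
    rw [← Finset.inf_union]
    exact le_iSup₂_of_le (t ∪ s) ⟨
      U.1.lower (show OrderDual.toDual (t ∪ s) ≤ OrderDual.toDual t from
        Finset.subset_union_left) ht,
      V.1.lower (show OrderDual.toDual (t ∪ s) ≤ OrderDual.toDual s from
        Finset.subset_union_right) hs⟩ le_rfl
  map_top' := by
    refine top_le_iff.1 (le_iSup₂_of_le ∅ ?_ ?_)
    · exact Set.mem_univ _
    · rw [Finset.inf_empty]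
  map_sSup' A := by
    rw [M.gc_liftFun_below.l_sSup, sSup_image]

theorem lift_le_iff (M : T.Model F) {U : T.opens} {b : F} : M.lift U ≤ b ↔ U ≤ M.below b :=
  M.liftFun_le_iff

theorem lift_restrict_Iic (M : T.Model F) (t : Finset T.Atom) :
    M.lift (T.opens.restrict (LowerSet.Iic (OrderDual.toDual t))) = t.inf M.val :=
  eq_of_forall_ge_iff fun b => by
    rw [lift_le_iff, restrict_Iic_le_iff]; rfl

@[simp]
theorem lift_basicOpen (M : T.Model F) (a : T.Atom) : M.lift (T.basicOpen a) = M.val a :=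
  (M.lift_restrict_Iic {a}).trans Finset.inf_singleton

/-- The image of a model under a frame homomorphism. -/
def map {G : Type*} [Frame G] (M : T.Model F) (φ : FrameHom F G) : T.Model G where
  val a := φ (M.val a)
  sound h C hA := by
    have := OrderHomClass.mono φ (M.sound h C hA)
    simpa only [map_finset_inf, map_iSup₂, Function.comp_def] using this

end Model

theorem restrict_Iic_eq (t : Finset T.Atom) :
    T.opens.restrict (LowerSet.Iic (OrderDual.toDual t)) = t.inf T.basicOpen := by
  classical
  induction t using Finset.induction_on with
  | empty =>
    rw [Finset.inf_empty, ← map_top T.opens.restrict]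
    congr 1
    exact top_le_iff.1 fun s _ => Finset.empty_subset s.ofDual
  | insert a s _ ih =>
    rw [Finset.inf_insert, ← ih, basicOpen, ← map_inf]
    congr 1
    ext x
    change insert a s ⊆ x.ofDual ↔ {a} ⊆ x.ofDual ∧ s ⊆ x.ofDual
    rw [Finset.insert_subset_iff, Finset.singleton_subset_iff]

theorem eq_iSup_restrict_Iic (U : T.opens) :
    U = ⨆ (t : Finset T.Atom) (_ : OrderDual.toDual t ∈ U.1),
      T.opens.restrict (LowerSet.Iic (OrderDual.toDual t)) := by
  apply le_antisymm
  · intro t ht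
    exact restrict_Iic_le_iff.1 (le_iSup₂_of_le t.ofDual ht le_rfl)
  · exact iSup₂_le fun t ht => restrict_Iic_le_iff.2 ht

/-- The atoms generate: every open is a join of finite meets of basic opens. -/
theorem frameHom_ext {F : Type*} [Frame F] {φ ψ : FrameHom T.opens F}
    (h : ∀ a, φ (T.basicOpen a) = ψ (T.basicOpen a)) : φ = ψ := by
  ext U
  rw [eq_iSup_restrict_Iic U]
  simp only [map_iSup₂, restrict_Iic_eq, map_finset_inf, Function.comp_def, h]

theorem Model.lift_map {F G : Type*} [Frame F] [Frame G] (M : T.Model F) (φ : FrameHom F G)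
    (U : T.opens) : (M.map φ).lift U = φ (M.lift U) := by
  have : (M.map φ).lift = φ.comp M.lift := frameHom_ext fun a => by
    simp [Model.map]
  rw [this]; rfl

/-! ### Spaces of countable theories have enough points -/

theorem finset_inf_prop {α : Type*} (s : Finset α) (v : α → Prop) :
    s.inf v ↔ ∀ a ∈ s, v a := by
  classical
  induction s using Finset.induction_on with
  | empty => simp
  | insert a s _ ih => simp [ih]

theorem iSup_finset_inf_prop {α : Type*} (C : Set (Finset α)) (v : α → Prop) :
    (⨆ c ∈ C, c.inf v) ↔ ∃ c ∈ C, ∀ a ∈ c, v a := by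
  simp only [iSup_Prop_eq, finset_inf_prop, exists_prop]

theorem Model.sound_prop (M : T.Model Prop) {h C} (hA : T.Ax h C) (hh : ∀ a ∈ h, M.val a) :
    ∃ c ∈ C, ∀ a ∈ c, M.val a :=
  (iSup_finset_inf_prop C M.val).1 (M.sound h C hA ((finset_inf_prop h M.val).2 hh))

/-- An ordinary model, given by its true atoms. -/
def Model.ofProp (v : T.Atom → Prop)
    (hv : ∀ h C, T.Ax h C → (∀ a ∈ h, v a) → ∃ c ∈ C, ∀ a ∈ c, v a) : T.Model Prop where
  val := v
  sound h C hA hh := (iSup_finset_inf_prop C v).2 (hv h C hA ((finset_inf_prop h v).1 hh))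

/-- A theory is countable if it has countably many axioms. -/
def IsCountable (T : GeomTheory) : Prop :=
  {x : Finset T.Atom × Set (Finset T.Atom) | T.Ax x.1 x.2}.Countable

/-- A condition outside the open `V` of a countable theory can be forced to hold in an ordinary
model that lies outside `V`. -/
theorem IsCountable.exists_model (hT : T.IsCountable) (V : T.opens) (t : Finset T.Atom)
    (ht : OrderDual.toDual t ∉ V.1) :
    ∃ M : T.Model Prop, (∀ a ∈ t, M.val a) ∧
      ∀ s : Finset T.Atom, (∀ a ∈ s, M.val a) → OrderDual.toDual s ∉ V.1 := by
  classical
  let P := {s : Finset T.Atom // OrderDual.toDual s ∉ V.1}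
  let ι := {x : Finset T.Atom × Set (Finset T.Atom) // T.Ax x.1 x.2}
  have : Countable ι := hT.to_subtype
  have : Encodable ι := Encodable.ofCountable ι
  -- Conditions are the finite sets outside `V`, ordered by inclusion. A condition decides an axiom
  -- if it contains one of the disjuncts or if no extension of it contains the premise. Saturation
  -- of `V` makes the deciding conditions cofinal.
  let D : ι → Order.Cofinal P := fun x =>
    { carrier := {s | (∃ c ∈ x.1.2, c ⊆ s.1) ∨ ∀ r : P, s ≤ r → ¬ x.1.1 ⊆ r.1}
      isCofinal := by
        intro s
        by_cases hs : ∃ r : P, s ≤ r ∧ x.1.1 ⊆ r.1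
        · obtain ⟨r, hsr, hr⟩ := hs
          have : ∃ c ∈ x.1.2, ∃ q : Finset T.Atom, r.1 ⊆ q ∧ c ⊆ q ∧
              OrderDual.toDual q ∉ V.1 := by
            by_contra! H
            exact r.2 (V.2 x.1.1 x.1.2 x.2 r.1 hr H)
          obtain ⟨c, hc, q, hrq, hcq, hq⟩ := this
          exact ⟨⟨q, hq⟩, Or.inl ⟨c, hc, hcq⟩, hsr.trans hrq⟩
        · exact ⟨s, Or.inr fun r hr hx => hs ⟨r, hr, hx⟩, le_rfl⟩ }
  -- A generic ideal through `t`: countability lets it meet every `D x`. The atoms occurring in it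
  -- form the model.
  let I := Order.idealOfCofinals (⟨t, ht⟩ : P) D
  have hI : ∀ s : Finset T.Atom, (∀ a ∈ s, ∃ r ∈ I, a ∈ r.1) → ∃ r ∈ I, s ⊆ r.1 := by
    intro s
    induction s using Finset.induction_on with
    | empty => exact fun _ => ⟨_, Order.mem_idealOfCofinals _ D, Finset.empty_subset _⟩
    | insert a s _ ih =>
      intro hs
      obtain ⟨r, hr, hsr⟩ := ih fun b hb => hs b (Finset.mem_insert_of_mem hb)
      obtain ⟨q, hq, haq⟩ := hs a (Finset.mem_insert_self a s)
      obtain ⟨w, hw, hrw, hqw⟩ := I.directed r hr q hq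
      exact ⟨w, hw, Finset.insert_subset (hqw haq) (hsr.trans hrw)⟩
  refine ⟨Model.ofProp (fun a => ∃ r ∈ I, a ∈ r.1) ?_, ?_, ?_⟩
  · intro h C hA hh
    obtain ⟨r, hr, hhr⟩ := hI h hh
    obtain ⟨q, hqD, hq⟩ := Order.cofinal_meets_idealOfCofinals (⟨t, ht⟩ : P) D ⟨(h, C), hA⟩
    obtain ⟨w, hw, hrw, hqw⟩ := I.directed r hr q hq
    rcases hqD with ⟨c, hc, hcq⟩ | H
    · exact ⟨c, hc, fun a ha => ⟨q, hq, hcq ha⟩⟩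
    · exact absurd (hhr.trans hrw) (H w hqw)
  · exact fun a ha => ⟨_, Order.mem_idealOfCofinals _ D, ha⟩
  · intro s hs hsV
    obtain ⟨r, _, hsr⟩ := hI s hs
    exact r.2 (V.1.lower (show OrderDual.toDual r.1 ≤ OrderDual.toDual s from hsr) hsV)

/-- A condition in `U` but not in `V` would yield a model in which `U` is true and every member of
`V` fails. -/
theorem IsCountable.le_of_forall_model (hT : T.IsCountable) {U V : T.opens}
    (h : ∀ M : T.Model Prop, M.lift U → M.lift V) : U ≤ V := by
  intro t ht
  by_contra htV
  obtain ⟨M, hMt, hMV⟩ := hT.exists_model V t.ofDual htV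
  have hU : M.lift U := by
    have : t.ofDual.inf M.val ≤ M.lift U := le_iSup₂_of_le t.ofDual ht le_rfl
    exact this ((finset_inf_prop _ _).2 hMt)
  have hV := h M hU
  have : M.lift V ≤ False := by
    refine iSup₂_le fun s hs hMs => ?_
    exact hMV s ((finset_inf_prop _ _).1 hMs) hs
  exact this hV

theorem IsCountable.eq_of_forall_model (hT : T.IsCountable) {U V : T.opens}
    (h : ∀ M : T.Model Prop, M.lift U ↔ M.lift V) : U = V :=
  le_antisymm (hT.le_of_forall_model fun M => (h M).1) (hT.le_of_forall_model fun M => (h M).2)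

/-- A family of opens of the space of a countable theory `T` that restricts to a model of `S` at
each ordinary point of `[T]` is a model of `S` in the opens of `[T]`. -/
def IsCountable.modelOpens (hT : T.IsCountable) (W : S.Atom → T.opens)
    (hW : ∀ M : T.Model Prop, ∃ N : S.Model Prop, ∀ a, M.lift (W a) ↔ N.val a) :
    S.Model T.opens where
  val := W
  sound h C hA := by
    refine hT.le_of_forall_model fun M => ?_
    obtain ⟨N, hN⟩ := hW M
    have : (fun a => M.lift (W a)) = N.val := funext fun a => propext (hN a)
    simp only [map_finset_inf, map_iSup₂, Function.comp_def, this]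
    exact N.sound h C hA

/-! ### Countability of the theories -/

theorem IsCountable.adjoin (hT : T.IsCountable) {E : Finset T.Atom → Set (Finset T.Atom) → Prop}
    (hE : {x : Finset T.Atom × Set (Finset T.Atom) | E x.1 x.2}.Countable) :
    (T.adjoin E).IsCountable :=
  (hT.union hE).mono fun _ hx => hx

theorem IsCountable.prod (hT : T.IsCountable) (hS : S.IsCountable) : (T.prod S).IsCountable := by
  refine ((hT.image fun x => (x.1.map .inl, Finset.map .inl '' x.2)).union
    (hS.image fun x => (x.1.map .inr, Finset.map .inr '' x.2))).mono ?_
  rintro ⟨_, _⟩ h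
  cases h with
  | @left h C hA => exact Or.inl ⟨(h, C), hA, rfl⟩
  | @right h C hA => exact Or.inr ⟨(h, C), hA, rfl⟩

theorem IsCountable.family {I : Type} [Countable I] (hT : T.IsCountable) :
    (family I T).IsCountable := by
  refine (Set.countable_iUnion fun i : I => hT.image fun x =>
    (x.1.map (.sigmaMk i), Finset.map (.sigmaMk i) '' x.2)).mono ?_
  rintro ⟨_, _⟩ h
  cases h with
  | @mk i h C hA => exact Set.mem_iUnion.2 ⟨i, (h, C), hA, rfl⟩

theorem isCountable_discrete (S : Type) [Countable S] : (discrete S).IsCountable := by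
  refine ((Set.countable_singleton (∅, Set.range fun s : S => {s})).union
    (Set.countable_range fun h : Finset S => (h, (∅ : Set (Finset S))))).mono ?_
  rintro ⟨_, _⟩ h
  cases h with
  | exists_eq => exact Or.inl rfl
  | unique => exact Or.inr ⟨_, rfl⟩

end GeomTheory

instance : Countable RealAtom :=
  Function.Surjective.countable
    (f := fun x : ℚ ⊕ ℚ => Sum.elim RealAtom.lt RealAtom.gt x) (by
      rintro (q | q)
      · exact ⟨.inl q, rfl⟩
      · exact ⟨.inr q, rfl⟩)

/-- Each axiom scheme is indexed by rationals or by finite sets of atoms. -/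
theorem isCountable_dedekind : dedekind.IsCountable := by
  have : {x : Finset RealAtom × Set (Finset RealAtom) | DedekindAx x.1 x.2} ⊆
      Set.range (fun x : ℚ × ℚ =>
        (({.lt x.2} : Finset RealAtom), ({{.lt x.1}} : Set (Finset RealAtom)))) ∪
      Set.range (fun q : ℚ =>
        (({.lt q} : Finset RealAtom), {c : Finset RealAtom | ∃ r, q < r ∧ c = {.lt r}})) ∪
      {(∅, {c : Finset RealAtom | ∃ q, c = {.lt q}})} ∪
      Set.range (fun x : ℚ × ℚ =>
        (({.gt x.1} : Finset RealAtom), ({{.gt x.2}} : Set (Finset RealAtom)))) ∪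
      Set.range (fun r : ℚ =>
        (({.gt r} : Finset RealAtom), {c : Finset RealAtom | ∃ q, q < r ∧ c = {.gt q}})) ∪
      {(∅, {c : Finset RealAtom | ∃ q, c = {.gt q}})} ∪
      Set.range (fun h : Finset RealAtom => (h, (∅ : Set (Finset RealAtom)))) ∪
      Set.range (fun x : ℚ × ℚ =>
        ((∅ : Finset RealAtom), ({{.lt x.1}, {.gt x.2}} : Set (Finset RealAtom)))) := by
    rintro ⟨_, _⟩ h
    cases h with
    | lower q r => exact .inl <| .inl <| .inl <| .inl <| .inl <| .inl <| .inl ⟨(q, r), rfl⟩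
    | lower_rounded q => exact .inl <| .inl <| .inl <| .inl <| .inl <| .inl <| .inr ⟨q, rfl⟩
    | lower_inhabited => exact .inl <| .inl <| .inl <| .inl <| .inl <| .inr rfl
    | upper q r => exact .inl <| .inl <| .inl <| .inl <| .inr ⟨(q, r), rfl⟩
    | upper_rounded r => exact .inl <| .inl <| .inl <| .inr ⟨r, rfl⟩
    | upper_inhabited => exact .inl <| .inl <| .inr rfl
    | disjoint => exact .inl <| .inr ⟨_, rfl⟩
    | located q r => exact .inr ⟨(q, r), rfl⟩
  refine Set.Countable.mono this ?_
  simp only [Set.countable_union, Set.countable_singleton, Set.countable_range, and_self]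

theorem isCountable_dedekindNonneg : dedekindNonneg.IsCountable :=
  isCountable_dedekind.adjoin <| (Set.countable_singleton ({RealAtom.gt 0}, ∅)).mono <| by
    rintro ⟨_, _⟩ ⟨rfl, rfl⟩; rfl

theorem isCountable_dedekindNeg : dedekindNeg.IsCountable :=
  isCountable_dedekind.adjoin <| (Set.countable_singleton (∅, {{RealAtom.gt 0}})).mono <| by
    rintro ⟨_, _⟩ ⟨rfl, rfl⟩; rfl

open Classical in
theorem countable_absAx (R : Type) [CommRing R] [Countable R] :
    {x : Finset (realMaps R).Atom × Set (Finset (realMaps R).Atom) |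
      AbsAx R x.1 x.2}.Countable := by
  have : {x : Finset (realMaps R).Atom × Set (Finset (realMaps R).Atom) | AbsAx R x.1 x.2} ⊆
      Set.range (fun q : ℚ => (∅, {{absLt 0 q}})) ∪
      Set.range (fun q : ℚ => (∅, {{absLt 1 q}})) ∪
      Set.range (fun q : ℚ => (∅, {{ltAbs q 1}})) ∪
      Set.range (fun x : R × R × ℚ × ℚ =>
        ({absLt x.1 x.2.2.1, absLt x.2.1 x.2.2.2},
          {{absLt (x.1 * x.2.1) (x.2.2.1 * x.2.2.2)}})) ∪
      Set.range (fun x : R × R × ℚ => ({absLt (x.1 * x.2.1) x.2.2},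
        {c | ∃ r s : ℚ, 0 < r ∧ 0 < s ∧ r * s ≤ x.2.2 ∧ c = {absLt x.1 r, absLt x.2.1 s}})) ∪
      Set.range (fun x : R × R × ℚ × ℚ =>
        ({absLt x.1 x.2.2.1, absLt x.2.1 x.2.2.2},
          {{absLt (x.1 + x.2.1) (x.2.2.1 + x.2.2.2)}})) ∪
      Set.range (fun x : R => (∅, {c | x = 0 ∧ c = ∅} ∪ {{ltAbs 0 x}})) := by
    rintro ⟨_, _⟩ h
    cases h with
    | zero q => exact .inl <| .inl <| .inl <| .inl <| .inl <| .inl ⟨q, rfl⟩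
    | one_le q => exact .inl <| .inl <| .inl <| .inl <| .inl <| .inr ⟨q, rfl⟩
    | le_one q => exact .inl <| .inl <| .inl <| .inl <| .inr ⟨q, rfl⟩
    | mul_le x y r s => exact .inl <| .inl <| .inl <| .inr ⟨(x, y, r, s), rfl⟩
    | le_mul x y q => exact .inl <| .inl <| .inr ⟨(x, y, q), rfl⟩
    | add_le x y r s => exact .inl <| .inr ⟨(x, y, r, s), rfl⟩
    | pos_def x => exact .inr ⟨x, rfl⟩
  refine Set.Countable.mono this ?_
  simp only [Set.countable_union, Set.countable_range, and_self]

theorem isCountable_nonArchAbs : nonArchAbs.IsCountable :=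
  (isCountable_dedekindNonneg.family.adjoin (countable_absAx ℚ)).adjoin <|
    (Set.countable_singleton (∅, {c | ∃ n : ℤ, n ≠ 0 ∧ c = {absLt (n : ℚ) 1}})).mono <| by
      rintro ⟨_, _⟩ ⟨rfl, rfl⟩; rfl

theorem isCountable_primeNegReal : primeNegReal.IsCountable :=
  (isCountable_discrete Nat.Primes).prod isCountable_dedekindNeg

/-! ### Ordinary Dedekind reals -/

/-- The Dedekind section of a real number. -/
def realVal (x : ℝ) : RealAtom → Prop
  | .lt q => (q : ℝ) < x
  | .gt q => x < (q : ℝ)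

theorem realVal_lt {x : ℝ} {q : ℚ} : realVal x (.lt q) ↔ (q : ℝ) < x := Iff.rfl

theorem realVal_gt {x : ℝ} {q : ℚ} : realVal x (.gt q) ↔ x < (q : ℝ) := Iff.rfl

theorem dedekindAx_realVal (x : ℝ) {h C} (hA : DedekindAx h C) (hh : ∀ a ∈ h, realVal x a) :
    ∃ c ∈ C, ∀ a ∈ c, realVal x a := by
  cases hA with
  | lower q r hqr =>
    have hr : (r : ℝ) < x := hh _ (Finset.mem_singleton_self _)
    exact ⟨_, rfl, by simpa [realVal] using (Rat.cast_lt.2 hqr).trans hr⟩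
  | lower_rounded q =>
    have hq : (q : ℝ) < x := hh _ (Finset.mem_singleton_self _)
    obtain ⟨r, hqr, hr⟩ := exists_rat_btwn hq
    exact ⟨_, ⟨r, Rat.cast_lt.1 hqr, rfl⟩, by simpa [realVal] using hr⟩
  | lower_inhabited =>
    obtain ⟨q, hq⟩ := exists_rat_lt x
    exact ⟨_, ⟨q, rfl⟩, by simpa [realVal] using hq⟩
  | upper q r hqr =>
    have hq : x < (q : ℝ) := hh _ (Finset.mem_singleton_self _)
    exact ⟨_, rfl, by simpa [realVal] using hq.trans (Rat.cast_lt.2 hqr)⟩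
  | upper_rounded r =>
    have hr : x < (r : ℝ) := hh _ (Finset.mem_singleton_self _)
    obtain ⟨q, hq, hqr⟩ := exists_rat_btwn hr
    exact ⟨_, ⟨q, Rat.cast_lt.1 hqr, rfl⟩, by simpa [realVal] using hq⟩
  | upper_inhabited =>
    obtain ⟨q, hq⟩ := exists_rat_gt x
    exact ⟨_, ⟨q, rfl⟩, by simpa [realVal] using hq⟩
  | disjoint q _ h1 h2 => exact absurd (hh _ h1) (lt_asymm (realVal_gt.1 (hh _ h2)))
  | located q r hqr =>
    rcases lt_or_ge (q : ℝ) x with hq | hq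
    · exact ⟨_, Or.inl rfl, by simpa [realVal] using hq⟩
    · exact ⟨_, Or.inr rfl, by simpa [realVal] using hq.trans_lt (Rat.cast_lt.2 hqr)⟩

/-- The real is the supremum of the lower half. Roundedness makes the inequalities strict, and
locatedness shows that the upper half contains every rational above the supremum. -/
theorem exists_eq_realVal (v : RealAtom → Prop)
    (hv : ∀ h C, DedekindAx h C → (∀ a ∈ h, v a) → ∃ c ∈ C, ∀ a ∈ c, v a) :
    ∃ x : ℝ, v = realVal x := by
  have lower : ∀ q r, q < r → v (.lt r) → v (.lt q) := fun q r hqr hr => by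
    simpa using hv _ _ (.lower q r hqr) (by simpa using hr)
  have lower_rounded : ∀ q, v (.lt q) → ∃ r, q < r ∧ v (.lt r) := fun q hq => by
    obtain ⟨_, ⟨r, hqr, rfl⟩, hr⟩ := hv _ _ (.lower_rounded q) (by simpa using hq)
    exact ⟨r, hqr, hr _ (Finset.mem_singleton_self _)⟩
  have upper_rounded : ∀ r, v (.gt r) → ∃ q, q < r ∧ v (.gt q) := fun r hr => by
    obtain ⟨_, ⟨q, hqr, rfl⟩, hq⟩ := hv _ _ (.upper_rounded r) (by simpa using hr)
    exact ⟨q, hqr, hq _ (Finset.mem_singleton_self _)⟩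
  have disjoint : ∀ q, v (.lt q) → ¬ v (.gt q) := fun q h1 h2 => by
    classical
    obtain ⟨_, h, _⟩ := hv {.lt q, .gt q} ∅ (.disjoint q _ (by simp) (by simp))
      (by simpa using ⟨h1, h2⟩)
    exact h
  have lt_of : ∀ q r, v (.lt q) → v (.gt r) → q < r := fun q r hq hr => by
    by_contra! h
    rcases h.lt_or_eq with h | rfl
    · exact disjoint r (lower r q h hq) hr
    · exact disjoint r hq hr
  obtain ⟨_, ⟨l, rfl⟩, hl⟩ := hv _ _ .lower_inhabited (by simp)
  obtain ⟨_, ⟨u, rfl⟩, hu⟩ := hv _ _ .upper_inhabited (by simp)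
  replace hl := hl _ (Finset.mem_singleton_self _)
  replace hu := hu _ (Finset.mem_singleton_self _)
  let s : Set ℝ := (fun q : ℚ => (q : ℝ)) '' {q | v (.lt q)}
  have hne : s.Nonempty := ⟨l, l, hl, rfl⟩
  have hle : ∀ r, v (.gt r) → ∀ y ∈ s, y ≤ (r : ℝ) := by
    rintro r hr _ ⟨q, hq, rfl⟩
    exact Rat.cast_le.2 (lt_of q r hq hr).le
  have hbdd : BddAbove s := ⟨u, hle u hu⟩
  refine ⟨sSup s, funext fun a => propext ?_⟩
  rcases a with q | r
  · refine ⟨fun hq => ?_, fun hq => ?_⟩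
    · obtain ⟨r, hqr, hr⟩ := lower_rounded q hq
      exact (Rat.cast_lt.2 hqr).trans_le (le_csSup hbdd ⟨r, hr, rfl⟩)
    · obtain ⟨_, ⟨r, hr, rfl⟩, hqr⟩ := exists_lt_of_lt_csSup hne hq
      exact lower q r (Rat.cast_lt.1 hqr) hr
  · refine ⟨fun hr => ?_, fun hr => ?_⟩
    · obtain ⟨q, hqr, hq⟩ := upper_rounded r hr
      exact (csSup_le hne (hle q hq)).trans_lt (Rat.cast_lt.2 hqr)
    -- With `q` strictly between the supremum and `r`, locatedness leaves only `.gt r`, since `.lt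
    -- q` would bound `q` by the supremum.
    · obtain ⟨q, hq, hqr⟩ := exists_rat_btwn (realVal_gt.1 hr)
      obtain ⟨c, rfl | rfl, hc⟩ := hv _ _ (.located q r (Rat.cast_lt.1 hqr)) (by simp)
      · exact absurd (le_csSup hbdd ⟨q, hc _ (Finset.mem_singleton_self _), rfl⟩) hq.not_ge
      · exact hc _ (Finset.mem_singleton_self _)

/-- Rational intervals form a base of the topology of `ℝ`. -/
theorem realMem_realVal {x : ℝ} {W : Set ℝ} (hW : IsOpen W) : realMem (realVal x) W ↔ x ∈ W := by
  simp only [realMem, iSup_Prop_eq, exists_prop]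
  constructor
  · rintro ⟨a, b, h, ha, hb⟩
    exact h ⟨ha, hb⟩
  · intro hx
    obtain ⟨l, u, hlu, h⟩ := mem_nhds_iff_exists_Ioo_subset.1 (hW.mem_nhds hx)
    obtain ⟨a, hla, hax⟩ := exists_rat_btwn hlu.1
    obtain ⟨b, hxb, hbu⟩ := exists_rat_btwn hlu.2
    exact ⟨a, b, (Set.Ioo_subset_Ioo hla.le hbu.le).trans h, hax, hxb⟩

theorem map_realMem {F G : Type*} [Frame F] [Frame G] (φ : FrameHom F G) (v : RealAtom → F)
    (W : Set ℝ) : φ (realMem v W) = realMem (fun a => φ (v a)) W := by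
  simp only [realMem, map_iSup, map_inf]

/-- Negation of Dedekind sections, on atoms. -/
def RealAtom.neg : RealAtom → RealAtom
  | .lt q => .gt (-q)
  | .gt q => .lt (-q)

theorem realVal_neg (x : ℝ) (a : RealAtom) : realVal x a.neg ↔ realVal (-x) a := by
  cases a
  · simpa [RealAtom.neg, realVal] using lt_neg
  · simpa [RealAtom.neg, realVal] using neg_lt

theorem realMem_neg {F : Type*} [Frame F] (v : RealAtom → F) (W : Set ℝ) :
    realMem (fun a => v a.neg) W = realMem v (-W) := by
  have key : ∀ (v : RealAtom → F) (W : Set ℝ), realMem (fun a => v a.neg) W ≤ realMem v (-W) := by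
    intro v W
    refine iSup_le fun a => iSup_le fun b => iSup_le fun h => ?_
    refine le_iSup_of_le (-b) (le_iSup_of_le (-a) (le_iSup_of_le ?_ ?_))
    · intro x hx
      push_cast at hx
      exact h ⟨by linarith [hx.2], by linarith [hx.1]⟩
    · rw [inf_comm]; exact le_rfl
  -- Negation is an involution, so the reverse inequality is `key` for the negated section and `-W`.
  refine le_antisymm (key v W) ?_
  have h := key (fun a => v a.neg) (-W)
  have hv : (fun a : RealAtom => v a.neg.neg) = v := by
    funext a; cases a <;> simp [RealAtom.neg]
  rwa [hv, neg_neg] at h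

/-- The ordinary points of `(0, ∞)`. -/
def dedekindPosModel (x : ℝ) (hx : 0 < x) : dedekindPos.Model Prop :=
  Model.ofProp (realVal x) <| by
    rintro h C (hA | ⟨rfl, rfl⟩) hh
    · exact dedekindAx_realVal x hA hh
    · exact ⟨_, rfl, by simpa [realVal] using hx⟩

/-! ### Ordinary points of `ℙ × (-∞, 0)` -/

/-- The point of `ℙ × (-∞, 0)` given by a prime and a negative real. -/
def primeNegRealModel (p : Nat.Primes) (t : ℝ) (ht : t < 0) : primeNegReal.Model Prop :=
  Model.ofProp (Sum.elim (· = p) (realVal t)) <| by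
    rintro h C (@⟨h, C, hA⟩ | @⟨h, C, hA⟩) hh
    · cases hA with
      | exists_eq => exact ⟨_, ⟨_, ⟨p, rfl⟩, rfl⟩, by simp⟩
      | unique q r _ hq hr hqr =>
        have h1 : q = p := hh (.inl q) (Finset.mem_map_of_mem _ hq)
        have h2 : r = p := hh (.inl r) (Finset.mem_map_of_mem _ hr)
        exact absurd (h1.trans h2.symm) hqr
    · have hh' : ∀ a ∈ h, realVal t a := fun a ha => hh (.inr a) (Finset.mem_map_of_mem _ ha)
      rcases hA with hA | ⟨rfl, rfl⟩
      · obtain ⟨c, hc, hv⟩ := dedekindAx_realVal t hA hh'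
        exact ⟨_, ⟨c, hc, rfl⟩, by simpa using hv⟩
      · exact ⟨_, ⟨_, rfl, rfl⟩, by simpa [realVal] using ht⟩

theorem primeNegReal_point (M : primeNegReal.Model Prop) :
    ∃ (p : Nat.Primes) (t : ℝ), t < 0 ∧ (∀ q, M.val (.inl q) ↔ q = p) ∧
      ∀ a, M.val (.inr a) ↔ realVal t a := by
  classical
  obtain ⟨_, ⟨_, ⟨p, rfl⟩, rfl⟩, hp⟩ := M.sound_prop (.left .exists_eq) (by simp)
  have hp' : M.val (.inl p) := hp _ (by simp)
  obtain ⟨t, ht⟩ := exists_eq_realVal (fun a => M.val (.inr a)) fun h C hA hh => by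
    obtain ⟨_, ⟨c, hc, rfl⟩, hv⟩ := M.sound_prop (.right (.inl hA)) (by simpa using hh)
    exact ⟨c, hc, fun a ha => hv _ (Finset.mem_map_of_mem _ ha)⟩
  obtain ⟨_, ⟨_, rfl, rfl⟩, hneg⟩ := M.sound_prop (.right (.inr ⟨rfl, rfl⟩)) (by simp)
  have hneg' : M.val (.inr (.gt 0)) := hneg _ (by simp)
  have ht' : ∀ a, M.val (.inr a) ↔ realVal t a := fun a => iff_of_eq (congrFun ht a)
  refine ⟨p, t, by simpa [realVal] using (ht' _).1 hneg', fun q => ⟨fun hq => ?_, ?_⟩, ht'⟩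
  · by_contra hqp
    obtain ⟨_, ⟨_, h, _⟩, _⟩ := M.sound_prop
      (.left (.unique q p {q, p} (by simp) (by simp) hqp)) (by simpa using ⟨hq, hp'⟩)
    exact h
  · rintro rfl; exact hp'

/-! ### Ordinary non-Archimedean absolute values -/

/-- Continuity of `(x + ε) * (y + ε)` at `ε = 0` leaves room for rational bounds of both factors,
positive even when `x` or `y` vanishes. -/
theorem exists_rat_mul_le {x y : ℝ} (hx : 0 ≤ x) (hy : 0 ≤ y) {q : ℝ} (h : x * y < q) :
    ∃ r s : ℚ, 0 < r ∧ 0 < s ∧ (r * s : ℝ) ≤ q ∧ x < r ∧ y < s := by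
  have hc : Filter.Tendsto (fun ε : ℝ => (x + ε) * (y + ε)) (nhdsWithin 0 (Set.Ioi 0))
      (nhds (x * y)) := by
    have : Continuous fun ε : ℝ => (x + ε) * (y + ε) := by fun_prop
    simpa using (this.tendsto 0).mono_left nhdsWithin_le_nhds
  obtain ⟨ε, hε, hpos⟩ :=
    ((hc.eventually_lt_const h).and self_mem_nhdsWithin).exists
  replace hpos : 0 < ε := hpos
  obtain ⟨r, hxr, hr⟩ := exists_rat_btwn (lt_add_of_pos_right x hpos)
  obtain ⟨s, hys, hs⟩ := exists_rat_btwn (lt_add_of_pos_right y hpos)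
  refine ⟨r, s, Rat.cast_pos.1 (hx.trans_lt hxr), Rat.cast_pos.1 (hy.trans_lt hys), ?_, hxr, hys⟩
  exact (mul_le_mul hr.le hs.le (hy.trans hys.le) (by linarith)).trans hε.le

/-- The point of the space of non-Archimedean absolute values given by an absolute value. -/
def nonArchModel (N : AbsoluteValue ℚ ℝ) (hN : ∃ n : ℤ, n ≠ 0 ∧ N n < 1) :
    nonArchAbs.Model Prop :=
  Model.ofProp (fun a => realVal (N a.1) a.2) <| by
    rintro h C ((@⟨x, h, C, hA⟩ | hA) | ⟨rfl, rfl⟩) hh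
    · have hh' : ∀ a ∈ h, realVal (N x) a := fun a ha => hh ⟨x, a⟩ (Finset.mem_map_of_mem _ ha)
      rcases hA with hA | ⟨rfl, rfl⟩
      · obtain ⟨c, hc, hv⟩ := dedekindAx_realVal (N x) hA hh'
        exact ⟨_, ⟨c, hc, rfl⟩, by simpa using hv⟩
      · have : N x < ((0 : ℚ) : ℝ) := hh' _ (Finset.mem_singleton_self _)
        exact absurd this (by simp)
    · cases hA with
      | zero q hq => exact ⟨_, rfl, by simpa [realVal] using hq⟩
      | one_le q hq => exact ⟨_, rfl, by simpa [realVal] using (by exact_mod_cast hq)⟩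
      | le_one q hq => exact ⟨_, rfl, by simpa [realVal] using (by exact_mod_cast hq)⟩
      | mul_le x y r s =>
        have h1 : N x < r := hh (absLt x r) (by simp)
        have h2 : N y < s := hh (absLt y s) (by simp)
        exact ⟨_, rfl, by simpa [realVal] using mul_lt_mul'' h1 h2 (N.nonneg x) (N.nonneg y)⟩
      | le_mul x y q =>
        have h1 : N (x * y) < q := hh (absLt (x * y) q) (by simp)
        rw [map_mul] at h1
        obtain ⟨r, s, hr, hs, hrs, hxr, hys⟩ := exists_rat_mul_le (N.nonneg x) (N.nonneg y) h1
        exact ⟨_, ⟨r, s, hr, hs, by exact_mod_cast hrs, rfl⟩,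
          by simpa [realVal] using ⟨hxr, hys⟩⟩
      | add_le x y r s =>
        have h1 : N x < r := hh (absLt x r) (by simp)
        have h2 : N y < s := hh (absLt y s) (by simp)
        exact ⟨_, rfl, by simpa [realVal] using (N.add_le x y).trans_lt (add_lt_add h1 h2)⟩
      | pos_def x =>
        rcases eq_or_ne x 0 with rfl | hx
        · exact ⟨∅, Or.inl ⟨rfl, rfl⟩, by simp⟩
        · exact ⟨_, Or.inr rfl, by simpa [realVal] using hx⟩
    · obtain ⟨n, hn, hn1⟩ := hN
      exact ⟨_, ⟨n, hn, rfl⟩, by simpa [realVal] using hn1⟩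

/-- Each value is a real by `exists_eq_realVal`; the axioms on atoms become the laws of an absolute
value by comparison with rational upper bounds. -/
theorem nonArchAbs_point (M : nonArchAbs.Model Prop) :
    ∃ N : AbsoluteValue ℚ ℝ, (∃ n : ℤ, n ≠ 0 ∧ N n < 1) ∧
      ∀ (x : ℚ) (a : RealAtom), M.val (⟨x, a⟩ : Σ _ : ℚ, RealAtom) ↔ realVal (N x) a := by
  classical
  have hreal : ∀ x : ℚ, ∃ y : ℝ,
      (fun a => M.val (⟨x, a⟩ : Σ _ : ℚ, RealAtom)) = realVal y := fun x =>
    exists_eq_realVal _ fun h C hA hh => by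
      obtain ⟨_, ⟨c, hc, rfl⟩, hv⟩ :=
        M.sound_prop (.inl (.inl (.mk x (.inl hA)))) (by simpa using hh)
      exact ⟨c, hc, fun a ha => hv _ (Finset.mem_map_of_mem (.sigmaMk x) ha)⟩
  choose N hN using hreal
  have hgt : ∀ x q, M.val (absLt x q) ↔ N x < q := fun x q =>
    iff_of_eq (congrFun (hN x) (.gt q))
  have hlt : ∀ q x, M.val (ltAbs q x) ↔ q < N x := fun q x =>
    iff_of_eq (congrFun (hN x) (.lt q))
  have nonneg : ∀ x, 0 ≤ N x := fun x => by
    by_contra! h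
    obtain ⟨_, ⟨_, h, _⟩, _⟩ :=
      M.sound_prop (.inl (.inl (.mk x (.inr ⟨rfl, rfl⟩)))) (by simpa [hgt] using h)
    exact h
  have zero : N 0 = 0 := le_antisymm (by
    refine le_of_forall_lt_rat_imp_le fun q hq => ?_
    obtain ⟨_, rfl, h⟩ := M.sound_prop (.inl (.inr (.zero q (by exact_mod_cast hq)))) (by simp)
    exact ((hgt 0 q).1 (h _ (by simp))).le) (nonneg 0)
  have mul_le : ∀ x y, N (x * y) ≤ N x * N y := fun x y => by
    refine le_of_forall_lt_rat_imp_le fun q hq => ?_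
    obtain ⟨r, s, _, _, hrs, hx, hy⟩ := exists_rat_mul_le (nonneg x) (nonneg y) hq
    obtain ⟨_, rfl, h⟩ := M.sound_prop (.inl (.inr (.mul_le x y r s)))
      (by simpa [hgt] using ⟨hx, hy⟩)
    have := (hgt _ _).1 (h _ (Finset.mem_singleton_self _))
    push_cast at this
    exact this.le.trans hrs
  have le_mul : ∀ x y, N x * N y ≤ N (x * y) := fun x y => by
    refine le_of_forall_lt_rat_imp_le fun q hq => ?_
    obtain ⟨_, ⟨r, s, hr, hs, hrs, rfl⟩, h⟩ := M.sound_prop (.inl (.inr (.le_mul x y q)))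
      (by simpa [hgt] using hq)
    have hx := (hgt _ _).1 (h (absLt x r) (by simp))
    have hy := (hgt _ _).1 (h (absLt y s) (by simp))
    calc N x * N y ≤ r * s := mul_le_mul hx.le hy.le (nonneg y) (by exact_mod_cast hr.le)
      _ ≤ q := by exact_mod_cast hrs
  have add_le : ∀ x y, N (x + y) ≤ N x + N y := fun x y => by
    refine le_of_forall_pos_lt_add fun ε hε => ?_
    obtain ⟨r, hx, hr⟩ := exists_rat_btwn (lt_add_of_pos_right (N x) (half_pos hε))
    obtain ⟨s, hy, hs⟩ := exists_rat_btwn (lt_add_of_pos_right (N y) (half_pos hε))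
    obtain ⟨_, rfl, h⟩ := M.sound_prop (.inl (.inr (.add_le x y r s)))
      (by simpa [hgt] using ⟨hx, hy⟩)
    have := (hgt _ _).1 (h _ (Finset.mem_singleton_self _))
    push_cast at this
    linarith
  have eq_zero : ∀ x, N x = 0 → x = 0 := fun x hx => by
    obtain ⟨_, ⟨h, rfl⟩ | rfl, hc⟩ := M.sound_prop (.inl (.inr (.pos_def x))) (by simp)
    · exact h
    · have := (hlt _ _).1 (hc _ (Finset.mem_singleton_self _))
      simp [hx] at this
  obtain ⟨_, ⟨n, hn, rfl⟩, h⟩ := M.sound_prop (.inr ⟨rfl, rfl⟩) (by simp)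
  have hn1 := (hgt _ _).1 (h _ (Finset.mem_singleton_self _))
  refine ⟨⟨⟨N, fun x y => (mul_le x y).antisymm (le_mul x y)⟩, nonneg,
    fun x => ⟨eq_zero x, ?_⟩, add_le⟩, ⟨n, hn, by simpa using hn1⟩,
    fun x a => iff_of_eq (congrFun (hN x) a)⟩
  rintro rfl; exact zero

/-! ### Powers of `p`-adic absolute values and Ostrowski's theorem -/

/-- A positive power of the `p`-adic absolute value. -/
noncomputable def padicPow (p : Nat.Primes) (c : ℝ) (hc : 0 < c) : AbsoluteValue ℚ ℝ :=
  haveI : Fact (p : ℕ).Prime := ⟨p.2⟩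
  { toFun := fun x => (padicNorm p x : ℝ) ^ c
    map_mul' := fun x y => by
      rw [padicNorm.mul, Rat.cast_mul, Real.mul_rpow] <;>
        exact_mod_cast padicNorm.nonneg _
    nonneg' := fun x => Real.rpow_nonneg (by exact_mod_cast padicNorm.nonneg _) _
    eq_zero' := fun x => by
      rw [Real.rpow_eq_zero (by exact_mod_cast padicNorm.nonneg _) hc.ne', Rat.cast_eq_zero]
      exact ⟨padicNorm.zero_of_padicNorm_eq_zero, fun h => by rw [h, padicNorm.zero]⟩
    add_le' := fun x y => by
      have hx : (0 : ℝ) ≤ padicNorm p x := by exact_mod_cast padicNorm.nonneg _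
      have hy : (0 : ℝ) ≤ padicNorm p y := by exact_mod_cast padicNorm.nonneg _
      have hxy : (0 : ℝ) ≤ padicNorm p (x + y) := by exact_mod_cast padicNorm.nonneg _
      have h : (padicNorm p (x + y) : ℝ) ≤ max (padicNorm p x : ℝ) (padicNorm p y) := by
        exact_mod_cast padicNorm.nonarchimedean
      have hx' := Real.rpow_nonneg hx c
      have hy' := Real.rpow_nonneg hy c
      rcases le_max_iff.1 h with h | h
      · linarith [Real.rpow_le_rpow hxy h hc.le]
      · linarith [Real.rpow_le_rpow hxy h hc.le] }

theorem padicPow_apply (p : Nat.Primes) (c : ℝ) (hc : 0 < c) (x : ℚ) :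
    padicPow p c hc x = (padicNorm p x : ℝ) ^ c := rfl

theorem padicPow_prime_self (p : Nat.Primes) (c : ℝ) (hc : 0 < c) :
    padicPow p c hc (p : ℕ) = (p : ℝ) ^ (-c) := by
  rw [padicPow_apply, padicNorm.padicNorm_p p.2.one_lt, Rat.cast_inv, Rat.cast_natCast,
    Real.inv_rpow (by positivity), Real.rpow_neg (by positivity)]

/-- Primes other than `p` are `p`-adic units. Hence the open `|q| < 1` recovers the prime. -/
theorem padicPow_prime_lt_one_iff (p q : Nat.Primes) (c : ℝ) (hc : 0 < c) :
    padicPow p c hc (q : ℕ) < 1 ↔ q = p := by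
  have : Fact (p : ℕ).Prime := ⟨p.2⟩
  have : Fact (q : ℕ).Prime := ⟨q.2⟩
  constructor
  · intro h
    by_contra hqp
    rw [padicPow_apply, padicNorm.padicNorm_of_prime_of_ne
      (fun h => hqp (Subtype.ext h.symm))] at h
    simp at h
  · rintro rfl
    rw [padicPow_prime_self]
    exact Real.rpow_lt_one_of_one_lt_of_neg (by exact_mod_cast q.2.one_lt) (neg_lt_zero.2 hc)

/-- **Ostrowski's theorem** in the non-Archimedean case. -/
theorem exists_eq_padicPow (N : AbsoluteValue ℚ ℝ) (hN : ∃ n : ℤ, n ≠ 0 ∧ N n < 1) :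
    ∃ (p : Nat.Primes) (c : ℝ) (hc : 0 < c), N = padicPow p c hc := by
  obtain ⟨n, hn, hn1⟩ := hN
  have hnt : N.IsNontrivial := ⟨n, by exact_mod_cast hn, hn1.ne⟩
  rcases Rat.AbsoluteValue.equiv_real_or_padic N hnt with h | ⟨p, ⟨hp, h⟩, _⟩
  -- Equivalent absolute values have the same open unit ball, and the usual one has no non-zero
  -- integer in it.
  · have h1 := (AbsoluteValue.IsEquiv.lt_one_iff h).1 hn1
    rw [Rat.AbsoluteValue.real_eq_abs] at h1
    have : |n| < 1 := by exact_mod_cast h1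
    exact absurd (Int.abs_lt_one_iff.1 this) hn
  -- Equivalent absolute values are positive powers of each other.
  · obtain ⟨c, hc, hcN⟩ := AbsoluteValue.isEquiv_iff_exists_rpow_eq.1 (Setoid.symm h)
    exact ⟨⟨p, hp.out⟩, c, hc, AbsoluteValue.ext fun x => (congrFun hcN x).symm⟩

/-- The case `c = 0`, needed for `|0|`, is why `t < 0` matters: `0 ^ (-t)` jumps to `1` at `t = 0`.
-/
theorem isOpen_rpow_lt (c q : ℝ) : IsOpen {t : ℝ | t < 0 ∧ c ^ (-t) < q} := by
  have : ContinuousOn (fun t : ℝ => c ^ (-t)) (Set.Iio 0) :=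
    continuousOn_const.rpow continuousOn_neg fun t ht => Or.inr (neg_pos.2 ht)
  exact this.isOpen_inter_preimage isOpen_Iio isOpen_Iio

theorem isOpen_lt_rpow (c q : ℝ) : IsOpen {t : ℝ | t < 0 ∧ q < c ^ (-t)} := by
  have : ContinuousOn (fun t : ℝ => c ^ (-t)) (Set.Iio 0) :=
    continuousOn_const.rpow continuousOn_neg fun t ht => Or.inr (neg_pos.2 ht)
  exact this.isOpen_inter_preimage isOpen_Iio isOpen_Ioi

/-! ### The isomorphism -/

/-- The reals `t < 0` for which the atom `a` holds of `|x|_p ^ (-t)`. -/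
def expSet (p : ℕ) (x : ℚ) (a : RealAtom) : Set ℝ :=
  {t | t < 0 ∧ realVal ((padicNorm p x : ℝ) ^ (-t)) a}

theorem isOpen_expSet (p : ℕ) (x : ℚ) (a : RealAtom) : IsOpen (expSet p x a) := by
  cases a
  · exact isOpen_lt_rpow _ _
  · exact isOpen_rpow_lt _ _

theorem lift_basicOpen_iff {T : GeomTheory} (M : T.Model Prop) (a : T.Atom) :
    M.lift (T.basicOpen a) ↔ M.val a :=
  iff_of_eq (M.lift_basicOpen a)

theorem lift_primeIs (M : primeNegReal.Model Prop) (p : Nat.Primes) :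
    M.lift (primeIs p) ↔ M.val (.inl p) :=
  lift_basicOpen_iff M (.inl p)

theorem lift_expAtom (M : primeNegReal.Model Prop) (a : RealAtom) :
    M.lift (expAtom a) ↔ M.val (.inr a) :=
  lift_basicOpen_iff M (.inr a)

theorem lift_realMem_expAtom {M : primeNegReal.Model Prop} {t : ℝ}
    (ht : ∀ a, M.val (.inr a) ↔ realVal t a) {W : Set ℝ} (hW : IsOpen W) :
    M.lift (realMem expAtom W) ↔ t ∈ W := by
  have h : (fun a => M.lift (expAtom a)) = realVal t := funext fun a => by
    exact propext ((lift_expAtom M a).trans (ht a))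
  rw [map_realMem, h, realMem_realVal hW]

/-- The open of `ℙ × (-∞, 0)` where the atom `a` holds of `|x|_p ^ (-t)`. -/
noncomputable def absOpen (x : ℚ) (a : RealAtom) : primeNegReal.opens :=
  ⨆ p : Nat.Primes, primeIs p ⊓ realMem expAtom (expSet p x a)

/-- At the point `(p, t)` only the summand of `p` in the join survives. -/
theorem lift_absOpen {M : primeNegReal.Model Prop} {p : Nat.Primes} {t : ℝ}
    (hp : ∀ q, M.val (.inl q) ↔ q = p) (ht : ∀ a, M.val (.inr a) ↔ realVal t a)
    (ht0 : t < 0) (x : ℚ) (a : RealAtom) :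
    M.lift (absOpen x a) ↔ realVal ((padicNorm p x : ℝ) ^ (-t)) a := by
  simp only [absOpen, map_iSup, map_inf, iSup_Prop_eq, inf_Prop_eq, lift_primeIs M, hp,
    lift_realMem_expAtom ht (isOpen_expSet _ x a), exists_eq_left]
  exact and_iff_right ht0

/-- The absolute value `|·|_p ^ (-t)`, at the generic point `(p, t)` of `ℙ × (-∞, 0)`. -/
noncomputable def genericAbs : nonArchAbs.Model primeNegReal.opens :=
  isCountable_primeNegReal.modelOpens (fun a => absOpen a.1 a.2) fun M => by
    obtain ⟨p, t, ht0, hp, ht⟩ := primeNegReal_point M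
    refine ⟨nonArchModel (padicPow p (-t) (neg_pos.2 ht0))
      ⟨(p : ℕ), by exact_mod_cast p.2.ne_zero, ?_⟩, fun a => lift_absOpen hp ht ht0 a.1 a.2⟩
    exact_mod_cast (padicPow_prime_lt_one_iff p p (-t) (neg_pos.2 ht0)).2 rfl

theorem nonArchAbs_point_padicPow (M : nonArchAbs.Model Prop) :
    ∃ (p : Nat.Primes) (c : ℝ) (hc : 0 < c), ∀ (x : ℚ) (a : RealAtom),
      M.val (⟨x, a⟩ : Σ _ : ℚ, RealAtom) ↔ realVal (padicPow p c hc x) a := by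
  obtain ⟨N, hN, h⟩ := nonArchAbs_point M
  obtain ⟨p, c, hc, rfl⟩ := exists_eq_padicPow N hN
  exact ⟨p, c, hc, h⟩

/-- The opens of the space of non-Archimedean absolute values that correspond to the atoms of
`ℙ × (-∞, 0)`: "the prime is `p`" becomes `|p| < 1`, and "`q < λ`" and "`λ < q`" become
`p ^ q < |p|` and `|p| < p ^ q` for a prime `p` with `|p| < 1`. -/
noncomputable def primeExpOpen : primeNegReal.Atom → nonArchAbs.opens
  | .inl p => nonArchAbs.basicOpen (absLt (p : ℕ) 1)
  -- Atoms compare only with rationals, while `p ^ q` may be irrational; hence the rational `r` in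
  -- between.
  | .inr (.lt q) => ⨆ (p : Nat.Primes) (r : ℚ) (_ : (p : ℝ) ^ (q : ℝ) ≤ r),
      nonArchAbs.basicOpen (absLt (p : ℕ) 1) ⊓ nonArchAbs.basicOpen (ltAbs r (p : ℕ))
  | .inr (.gt q) => ⨆ (p : Nat.Primes) (r : ℚ) (_ : (r : ℝ) ≤ (p : ℝ) ^ (q : ℝ)),
      nonArchAbs.basicOpen (absLt (p : ℕ) 1) ⊓ nonArchAbs.basicOpen (absLt (p : ℕ) r)

/-- Since `p > 1`, comparing `q` with `-c` amounts to comparing `p ^ q` with `p ^ (-c) = |p|`. -/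
theorem lift_primeExpOpen {M : nonArchAbs.Model Prop} {p : Nat.Primes} {c : ℝ} {hc : 0 < c}
    (h : ∀ (x : ℚ) (a : RealAtom),
      M.val (⟨x, a⟩ : Σ _ : ℚ, RealAtom) ↔ realVal (padicPow p c hc x) a)
    (b : primeNegReal.Atom) :
    M.lift (primeExpOpen b) ↔ Sum.elim (· = p) (realVal (-c)) b := by
  have h1 : ∀ q : Nat.Primes, M.val (absLt (q : ℕ) 1) ↔ q = p := fun q => by
    rw [h, realVal_gt, Rat.cast_one, padicPow_prime_lt_one_iff]
  have hp1 : (1 : ℝ) < p := by exact_mod_cast p.2.one_lt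
  rcases b with q | q | q
  · exact (lift_basicOpen_iff M _).trans (h1 q)
  · simp only [primeExpOpen, map_iSup, map_inf, iSup_Prop_eq, inf_Prop_eq, lift_basicOpen_iff M,
      h1, h, realVal_lt, Sum.elim_inr]
    rw [← Real.rpow_lt_rpow_left_iff hp1, ← padicPow_prime_self p c hc]
    constructor
    · rintro ⟨_, r, hr, rfl, hlt⟩
      exact hr.trans_lt hlt
    · intro hlt
      obtain ⟨r, hr, hr'⟩ := exists_rat_btwn hlt
      exact ⟨p, r, hr.le, rfl, hr'⟩
  · simp only [primeExpOpen, map_iSup, map_inf, iSup_Prop_eq, inf_Prop_eq, lift_basicOpen_iff M,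
      h1, h, realVal_gt, Sum.elim_inr]
    rw [← Real.rpow_lt_rpow_left_iff hp1, ← padicPow_prime_self p c hc]
    constructor
    · rintro ⟨_, r, hr, rfl, hlt⟩
      exact hlt.trans_le hr
    · intro hlt
      obtain ⟨r, hr, hr'⟩ := exists_rat_btwn hlt
      exact ⟨p, r, hr'.le, rfl, hr⟩

/-- The prime and the exponent of the generic non-Archimedean absolute value. -/
noncomputable def genericPrimeExp : primeNegReal.Model nonArchAbs.opens :=
  isCountable_nonArchAbs.modelOpens primeExpOpen fun M => by
    obtain ⟨p, c, hc, h⟩ := nonArchAbs_point_padicPow M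
    exact ⟨primeNegRealModel p (-c) (neg_lt_zero.2 hc), lift_primeExpOpen h⟩

theorem genericAbs_lift_genericPrimeExp_lift (U : primeNegReal.opens) :
    genericAbs.lift (genericPrimeExp.lift U) = U := by
  have : genericAbs.lift.comp genericPrimeExp.lift = FrameHom.id _ := frameHom_ext fun b => by
    refine isCountable_primeNegReal.eq_of_forall_model fun M => ?_
    obtain ⟨p, t, ht0, hp, ht⟩ := primeNegReal_point M
    change M.lift (genericAbs.lift (genericPrimeExp.lift _)) ↔ M.lift _
    -- Pulled back to the point `(p, t)`, the generic absolute value is `|·|_p ^ (-t)`, from which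
    -- `p` and `t` are read off again.
    rw [FrameHom.id_apply, lift_basicOpen_iff, Model.lift_basicOpen, ← Model.lift_map]
    refine (lift_primeExpOpen (p := p) (c := -t) (hc := neg_pos.2 ht0)
      (fun x a => lift_absOpen hp ht ht0 x a) b).trans ?_
    rcases b with q | a
    · exact (hp q).symm
    · rw [neg_neg]; exact (ht a).symm
  exact DFunLike.congr_fun this U

theorem genericPrimeExp_lift_genericAbs_lift (U : nonArchAbs.opens) :
    genericPrimeExp.lift (genericAbs.lift U) = U := by
  have : genericPrimeExp.lift.comp genericAbs.lift = FrameHom.id _ := frameHom_ext fun b => by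
    refine isCountable_nonArchAbs.eq_of_forall_model fun M => ?_
    obtain ⟨p, c, hc, h⟩ := nonArchAbs_point_padicPow M
    change M.lift (genericPrimeExp.lift (genericAbs.lift _)) ↔ M.lift _
    rw [FrameHom.id_apply, lift_basicOpen_iff, Model.lift_basicOpen, ← Model.lift_map]
    refine (lift_absOpen (M := genericPrimeExp.map M.lift) (p := p) (t := -c)
      (fun q => lift_primeExpOpen h (.inl q)) (fun a => lift_primeExpOpen h (.inr a))
      (neg_lt_zero.2 hc) b.1 b.2).trans ?_
    rw [neg_neg]
    exact (h b.1 b.2).symm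
  exact DFunLike.congr_fun this U

/-- The isomorphism `[av_NA] ≅ ℙ × (-∞, 0)`. -/
noncomputable def nonArchAbsIso : nonArchAbs.space ≅ primeNegReal.space where
  -- Maps of locales are frame homomorphisms reversed, so `hom` is given by the prime and exponent
  -- of an absolute value.
  hom := (Frm.ofHom genericPrimeExp.lift).op
  inv := (Frm.ofHom genericAbs.lift).op
  hom_inv_id := Quiver.Hom.unop_inj <| by
    ext U; exact genericPrimeExp_lift_genericAbs_lift U
  inv_hom_id := Quiver.Hom.unop_inj <| by
    ext U; exact genericAbs_lift_genericPrimeExp_lift U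

theorem invImage_nonArchAbsIso_inv (x : ℚ) (a : RealAtom) :
    Locale.invImage nonArchAbsIso.inv
      (nonArchAbs.basicOpen (⟨x, a⟩ : Σ _ : ℚ, RealAtom)) = absOpen x a :=
  genericAbs.lift_basicOpen _

/-! ### The exponent at an arbitrary stage -/

/-- The positive real `-t`, at the generic point `(p, t)` of `ℙ × (-∞, 0)`. -/
noncomputable def genericPos : dedekindPos.Model primeNegReal.opens :=
  isCountable_primeNegReal.modelOpens (fun a => expAtom a.neg) fun M => by
    obtain ⟨p, t, ht0, -, ht⟩ := primeNegReal_point M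
    refine ⟨dedekindPosModel (-t) (neg_pos.2 ht0), fun a => ?_⟩
    rw [lift_expAtom, ht, realVal_neg]
    rfl

/-- Distinct primes give disjoint opens, so only one summand of `absOpen` meets `primeIs p`. Being
an equation of opens, this is preserved by every frame homomorphism. -/
theorem primeIs_inf_absOpen (p : Nat.Primes) (x : ℚ) (a : RealAtom) :
    primeIs p ⊓ absOpen x a = primeIs p ⊓ realMem expAtom (expSet p x a) := by
  refine isCountable_primeNegReal.eq_of_forall_model fun M => ?_
  obtain ⟨q, t, ht0, hq, ht⟩ := primeNegReal_point M
  rw [map_inf, map_inf]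
  simp only [inf_Prop_eq, lift_absOpen hq ht ht0, lift_realMem_expAtom ht (isOpen_expSet p x a),
    lift_primeIs M, hq]
  refine and_congr_right ?_
  rintro rfl
  exact (and_iff_right ht0).symm

theorem absOpen_prime_lt_one (p : Nat.Primes) : absOpen (p : ℕ) (.gt 1) = primeIs p := by
  refine isCountable_primeNegReal.eq_of_forall_model fun M => ?_
  obtain ⟨q, t, ht0, hq, ht⟩ := primeNegReal_point M
  rw [lift_absOpen hq ht ht0, lift_primeIs M, hq, realVal_gt, Rat.cast_one]
  exact padicPow_prime_lt_one_iff q p (-t) (neg_pos.2 ht0)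

/-- Through the isomorphism, `M` becomes a homomorphism `φ` on the opens of `ℙ × (-∞, 0)`. The
hypothesis says that `φ` sends `primeIs p` to `⊤`, so `primeIs_inf_absOpen` leaves a condition on
the exponent alone. -/
theorem exists_exponent {F : Type u} [Frame F] (M : nonArchAbs.Model F) (p : Nat.Primes)
    (hp : M.val (absLt (p : ℕ) 1) = ⊤) :
    ∃ α : dedekindPos.Model F, ∀ (x : ℚ) (a : RealAtom),
      M.val (⟨x, a⟩ : Σ _ : ℚ, RealAtom) = realMem α.val (-expSet p x a) := by
  let φ : FrameHom primeNegReal.opens F := M.lift.comp genericPrimeExp.lift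
  have hM : ∀ x a, φ (absOpen x a) = M.val (⟨x, a⟩ : Σ _ : ℚ, RealAtom) := fun x a => by
    have h := genericPrimeExp_lift_genericAbs_lift
      (nonArchAbs.basicOpen (⟨x, a⟩ : Σ _ : ℚ, RealAtom))
    rw [Model.lift_basicOpen] at h
    exact (congrArg M.lift h).trans (M.lift_basicOpen _)
  have hφ : φ (primeIs p) = ⊤ := by rw [← absOpen_prime_lt_one, hM, hp]
  -- The exponent `α` is `-λ` at this stage; hence the reflected set `-expSet p x a`.
  refine ⟨genericPos.map φ, fun x a => ?_⟩
  have h := congrArg φ (primeIs_inf_absOpen p x a)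
  rw [map_inf, map_inf, hφ, top_inf_eq, top_inf_eq, hM, map_realMem] at h
  rw [h]
  change _ = realMem (fun a : RealAtom => φ (expAtom a.neg)) _
  rw [realMem_neg (fun a => φ (expAtom a)), neg_neg]

theorem neg_expSet (p : ℕ) (x : ℚ) (a : RealAtom) :
    -expSet p x a = {t : ℝ | 0 < t ∧ realVal ((padicNorm p x : ℝ) ^ t) a} := by
  ext t
  simp [expSet]

/-- The space of non-Archimedean (positive definite, Dedekind) absolute values on `ℚ` is
isomorphic to `ℙ × (-∞,0)`, where `(p, λ)` corresponds to the absolute value with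
`|x| = (p ^ ord_p x) ^ λ`, that is `|x| = |x|_p ^ (-λ)`.
Consequently each such absolute value with `|p| < 1` (a point at any stage, i.e. in any frame `F`)
is `|·|_p ^ α` for a Dedekind real `α > 0`; and each ordinary point is `|·|_p ^ α` for some prime
`p` and some real `α > 0`. -/
theorem proposition5p5 :
    (∃ e : nonArchAbs.space ≅ primeNegReal.space,
      ∀ (x q : ℚ),
        Locale.invImage e.inv (nonArchAbs.basicOpen (absLt x q)) =
          (⨆ p : Nat.Primes, primeIs p ⊓
            realMem expAtom {t : ℝ | t < 0 ∧ (padicNorm p x : ℝ) ^ (-t) < q}) ∧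
        Locale.invImage e.inv (nonArchAbs.basicOpen (ltAbs q x)) =
          (⨆ p : Nat.Primes, primeIs p ⊓
            realMem expAtom {t : ℝ | t < 0 ∧ (q : ℝ) < (padicNorm p x : ℝ) ^ (-t)})) ∧
    (∀ (F : Type u) [Frame F] (M : nonArchAbs.Model F) (p : ℕ), p.Prime →
      M.val (absLt (p : ℚ) 1) = ⊤ →
        ∃ α : dedekindPos.Model F, ∀ (x q : ℚ),
          M.val (absLt x q) =
            realMem α.val {t : ℝ | 0 < t ∧ (padicNorm p x : ℝ) ^ t < q} ∧
          M.val (ltAbs q x) =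
            realMem α.val {t : ℝ | 0 < t ∧ (q : ℝ) < (padicNorm p x : ℝ) ^ t}) ∧
    (∀ M : nonArchAbs.Model Prop, ∃ (p : ℕ) (α : ℝ), p.Prime ∧ 0 < α ∧ ∀ (x q : ℚ),
      (M.val (absLt x q) ↔ (padicNorm p x : ℝ) ^ α < q) ∧
      (M.val (ltAbs q x) ↔ (q : ℝ) < (padicNorm p x : ℝ) ^ α)) := by
  refine ⟨⟨nonArchAbsIso, fun x q => ⟨invImage_nonArchAbsIso_inv x (.gt q),
    invImage_nonArchAbsIso_inv x (.lt q)⟩⟩, ?_, ?_⟩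
  · intro F _ M p hp hM
    obtain ⟨α, hα⟩ := exists_exponent M ⟨p, hp⟩ hM
    simp only [neg_expSet] at hα
    exact ⟨α, fun x q => ⟨hα x (.gt q), hα x (.lt q)⟩⟩
  · intro M
    obtain ⟨p, c, hc, h⟩ := nonArchAbs_point_padicPow M
    exact ⟨p, c, p.2, hc, fun x q => ⟨h x (.gt q), h x (.lt q)⟩⟩
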